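/- A hypergraph $\mathcal G=(V,E)$ here has a finite vertex set $V$ and a finite multiset $E$ of edges, each edge being a multi-subset of $V$. It is $h$-uniform if every edge has $h$ elements counted with multiplicity. The degree of a vertex is its total number of occurrences among all edges. A $k$-edge-coloring assigns one of $k$ colors to every edge (copies of the same edge may receive different colors); $\mathcal G_i$ is the spanning sub-hypergraph formed by the edges of color $i$, and $d_i(u)$ is the degree of $u$ in $\mathcal G_i$. For $\alpha\in V$, $p\ge 0$ and a set $U\subseteq V\setminus\{\alpha\}$, $m(\alpha^p,U)$ is the multiplicity in $E$ of the edge consisting of $p$ copies of $\alpha$ and one copy of each element of $U$. A hypergraph is connected if any two of its vertices are linked by a sequence of vertices in which consecutive ones lie on a common edge. **Theorem.** Let $n,h,\lambda,k,r_1,\dots,r_k$ be positive integers with $n>h$ such that $h$ divides $r_i n$ for $1\le i\le k$ and $\sum_{i=1}^k r_i=\lambda\binom{n-1}{h-1}$. Then for every integer $\ell$ with $1\le \ell\le n$ there exist an $h$-uniform hypergraph $\mathcal G$ with vertex set $V$, $|V|=\ell$, a $k$-edge-coloring of $\mathcal G$, and a vertex $\alpha\in V$ such that 1. $d_i(\alpha)=r_i(n-\ell+1)$,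 and $d_i(u)=r_i$ for all $u\in V\setminus\{\alpha\}$, for $1\le i\le k$; 2. $m(\alpha^p,U)=\lambda\binom{n-\ell+1}{p}$ for all $p\ge 0$ and $U\subseteq V\setminus\{\alpha\}$ with $|U|=h-p$; 3. if $h\ge 2$, then $\mathcal G_i$ is connected for every $1\le i\le k$ with $r_i\ge 2$. -/

import Mathlib

/-- A hypergraph with multiple edges whose edges are multisets of vertices. `E` labels the edges
(so parallel edges are different labels), and `verts e` is the multi-subset of `V` that the edge
`e` stands for. -/
structure MultiHypergraph (V E : Type*) where
  verts : E → Multiset V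

namespace MultiHypergraph

variable {V E C : Type*}

/-- Every edge has exactly `h` vertices, counted with multiplicity. -/
def IsUniform (G : MultiHypergraph V E) (h : ℕ) : Prop :=
  ∀ e : E, Multiset.card (G.verts e) = h

/-- The total number of occurrences of `v` among all edges. -/
def degree [DecidableEq V] [Fintype E] (G : MultiHypergraph V E) (v : V) : ℕ :=
  ∑ e : E, (G.verts e).count v

/-- The number of edges that are equal to `M` as multisets of vertices. -/
def edgeMult [DecidableEq V] [Fintype E] (G : MultiHypergraph V E) (M : Multiset V) : ℕ :=
  (Finset.univ.filter fun e : E => G.verts e = M).card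

/-- `m(α^p, U)`: the multiplicity of the edge `{α^p} ∪ U`. -/
def mult [DecidableEq V] [Fintype E] (G : MultiHypergraph V E) (α : V) (p : ℕ)
    (U : Finset V) : ℕ :=
  G.edgeMult (Multiset.replicate p α + U.val)

/-- Two vertices lie on a common edge. -/
def Joined (G : MultiHypergraph V E) (u v : V) : Prop :=
  ∃ e : E, u ∈ G.verts e ∧ v ∈ G.verts e

/-- There is a vertex, and any two vertices are linked by a chain of vertices in which
consecutive ones lie on a common edge. -/
def IsConnected (G : MultiHypergraph V E) : Prop :=
  Nonempty V ∧ ∀ u v : V, Relation.ReflTransGen G.Joined u v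

/-- The spanning sub-hypergraph on the edges of color `i` of an edge-coloring `f`. -/
def colorClass (G : MultiHypergraph V E) (f : E → C) (i : C) :
    MultiHypergraph V {e : E // f e = i} where
  verts e := G.verts e.1

end MultiHypergraph

open Finset

/-! Amalgamation and detachment. Let `α` stand for all `n` vertices at once: there are `lam *
n.choose h` edges, each `h` copies of `α`, and `r i * n / h` of them get colour `i`. While `α`
stands for `m = n - j` vertices, a new vertex `j` is split off by choosing a set `Z` of edges, each
of which gives one copy of `α` to `j`. The ideal fractional choice puts weight `p e / m` on edge
`e`. Its sums are integers on every colour class (`r i`) and on every edge type `U e` (by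
`m.choose`-identities), so a rounding that respects both families keeps all degrees and
multiplicities right (`IsAmalgamation.detach`). The rounding is integrality of circulations
(`exists_int_rounding`, `exists_balanced_subset`).

For connectivity, each colour class is split into wings: classes connected without `α`, each still
containing `α`. The wings hit by `Z` merge at `j`; the danger is that the merged wing loses its last
copy of `α`. The invariant is that colour `i` has at most `(r i - 1) * m + 1` wings. Their total
`α`-weight is `r i * m`, so for `m ≥ 2` the wings of weight at least two carry weight at least `m`;
the rounding can therefore be made to hit one of them, and balance leaves a copy of `α` in it.
`card_touched_bound` shows that enough wings merge for the invariant to survive (`HasWings.detach`).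
-/

/-! ### Integrality of circulations -/

/-- A nonempty set `F` of arcs in which no node has total degree one carries a nonzero
circulation. -/
lemma exists_ne_zero_circulation {N A : Type*} [Fintype N] [DecidableEq N] [Fintype A]
    [DecidableEq A] (s t : A → N) (F : Finset A) (hF : F.Nonempty)
    (hdeg : ∀ v, #{a ∈ F | s a = v} + #{a ∈ F | t a = v} ≠ 1) :
    ∃ d : A → ℝ, d ≠ 0 ∧ (∀ a ∉ F, d a = 0) ∧
      ∀ v, ∑ a with s a = v, d a = ∑ a with t a = v, d a := by
  obtain ⟨a₀, ha₀⟩ := hF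
  set M : Finset N := F.image s ∪ F.image t
  have hsM : ∀ a ∈ F, s a ∈ M := fun a ha => mem_union_left _ (mem_image_of_mem _ ha)
  have htM : ∀ a ∈ F, t a ∈ M := fun a ha => mem_union_right _ (mem_image_of_mem _ ha)
  -- Every node of `M` carries at least two arc ends, and `F` has `2 * #F` of them.
  have hcard : #M ≤ #F := by
    have h1 : #F = ∑ v ∈ M, #{a ∈ F | s a = v} := card_eq_sum_card_fiberwise hsM
    have h2 : #F = ∑ v ∈ M, #{a ∈ F | t a = v} := card_eq_sum_card_fiberwise htM
    have h3 : ∑ v ∈ M, 2 ≤ ∑ v ∈ M, (#{a ∈ F | s a = v} + #{a ∈ F | t a = v}) := by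
      refine sum_le_sum fun v hv => ?_
      have h0 : #{a ∈ F | s a = v} + #{a ∈ F | t a = v} ≠ 0 := by
        intro h0
        rcases mem_union.1 hv with hv | hv <;> obtain ⟨a, ha, rfl⟩ := mem_image.1 hv
        · have : 0 < #{b ∈ F | s b = s a} := card_pos.2 ⟨a, by simp [ha]⟩
          omega
        · have : 0 < #{b ∈ F | t b = t a} := card_pos.2 ⟨a, by simp [ha]⟩
          omega
      have := hdeg v
      omega
    rw [sum_add_distrib, ← h1, ← h2, sum_const, smul_eq_mul] at h3
    omega
  let div (v : N) : (A → ℝ) →ₗ[ℝ] ℝ :=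
    ∑ a with s a = v, LinearMap.proj a - ∑ a with t a = v, LinearMap.proj a
  have hdiv : ∀ v d, div v d = ∑ a with s a = v, d a - ∑ a with t a = v, d a := by
    intro v d
    simp [div, LinearMap.sub_apply, LinearMap.sum_apply]
  -- One node can be left out because the divergences sum to zero; this makes the constraints fewer
  -- than the unknowns.
  let L : (A → ℝ) →ₗ[ℝ] ({a // a ∉ F} → ℝ) × ({v // v ∈ M.erase (s a₀)} → ℝ) :=
    (LinearMap.pi fun a => LinearMap.proj a.1).prod (LinearMap.pi fun v => div v.1)
  have hrank : Module.finrank ℝ (({a // a ∉ F} → ℝ) × ({v // v ∈ M.erase (s a₀)} → ℝ)) <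
      Module.finrank ℝ (A → ℝ) := by
    rw [Module.finrank_prod, Module.finrank_pi, Module.finrank_pi, Module.finrank_pi,
      Fintype.card_coe, card_erase_of_mem (hsM _ ha₀), Fintype.card_subtype_compl,
      Fintype.card_coe]
    have h1 := card_le_univ F
    have h2 : 0 < #M := card_pos.2 ⟨_, hsM _ ha₀⟩
    omega
  obtain ⟨d, hd, hd0⟩ := (Submodule.ne_bot_iff _).1
    (LinearMap.ker_ne_bot_of_finrank_lt (f := L) hrank)
  rw [LinearMap.mem_ker] at hd
  have hoff : ∀ a ∉ F, d a = 0 := fun a ha => congrFun (congrArg Prod.fst hd) ⟨a, ha⟩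
  have hzero : ∀ v, v ≠ s a₀ → div v d = 0 := by
    intro v hv
    by_cases hvM : v ∈ M
    · exact congrFun (congrArg Prod.snd hd) ⟨v, mem_erase.2 ⟨hv, hvM⟩⟩
    · rw [hdiv, sum_eq_zero, sum_eq_zero, sub_zero]
      · intro a ha
        refine hoff a fun haF => hvM ?_
        rw [← (mem_filter.1 ha).2]; exact htM a haF
      · intro a ha
        refine hoff a fun haF => hvM ?_
        rw [← (mem_filter.1 ha).2]; exact hsM a haF
  have hall : ∑ v, div v d = 0 := by
    simp_rw [hdiv]
    rw [sum_sub_distrib, sum_fiberwise, sum_fiberwise, sub_self]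
  refine ⟨d, hd0, hoff, fun v => ?_⟩
  rw [← sub_eq_zero, ← hdiv]
  by_cases hv : v = s a₀
  · rw [hv]
    rwa [sum_eq_single (s a₀) (fun v _ hv => hzero v hv) (by simp)] at hall
  · exact hzero v hv

/-- If `x` lies in the integral box `[lo, hi]` and `d` is nonzero and vanishes wherever `x` is an
integer, then some `x + c • d` stays in the box and is an integer at some place where `x` is
not. -/
lemma exists_smul_add_mem_box {A : Type*} [Fintype A] (x d : A → ℝ) (lo hi : A → ℤ)
    (hlo : ∀ a, (lo a : ℝ) ≤ x a) (hhi : ∀ a, x a ≤ hi a) (hd : d ≠ 0)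
    (hint : ∀ a, (∃ z : ℤ, x a = z) → d a = 0) :
    ∃ c : ℝ, (∀ a, (lo a : ℝ) ≤ x a + c * d a) ∧ (∀ a, x a + c * d a ≤ hi a) ∧
      ∃ a, (¬ ∃ z : ℤ, x a = z) ∧ ∃ z : ℤ, x a + c * d a = z := by
  classical
  obtain ⟨a₁, ha₁⟩ := Function.ne_iff.1 hd
  let S : Finset A := {a | d a ≠ 0}
  -- The time at which coordinate `a`, moving in direction `d`, reaches the bound ahead of it; the
  -- earliest such time is used.
  let τ : A → ℝ := fun a => if 0 < d a then (hi a - x a) / d a else (lo a - x a) / d a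
  obtain ⟨b, hb, hmin⟩ := exists_min_image S τ ⟨a₁, by simpa [S] using ha₁⟩
  have hbd : d b ≠ 0 := by simpa [S] using hb
  have hτ0 : ∀ a, d a ≠ 0 → 0 ≤ τ a := by
    intro a ha
    simp only [τ]
    split_ifs with h
    · exact div_nonneg (sub_nonneg.2 (hhi a)) h.le
    · exact div_nonneg_of_nonpos (sub_nonpos.2 (hlo a)) (not_lt.1 h)
  have hb0 := hτ0 b hbd
  refine ⟨τ b, fun a => ?_, fun a => ?_, b, fun h => hbd (hint b h), ?_⟩
  · by_cases ha : d a = 0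
    · simpa [ha] using hlo a
    · rcases lt_or_gt_of_ne ha with h | h
      · have h1 := hmin a (by simpa [S] using ha)
        have h2 : τ a = (lo a - x a) / d a := by simp [τ, h.not_gt]
        rw [h2, le_div_iff_of_neg h] at h1
        linarith
      · have := mul_nonneg hb0 h.le
        linarith [hlo a]
  · by_cases ha : d a = 0
    · simpa [ha] using hhi a
    · rcases lt_or_gt_of_ne ha with h | h
      · have := mul_nonpos_of_nonneg_of_nonpos hb0 h.le
        linarith [hhi a]
      · have h1 := hmin a (by simpa [S] using ha)
        have h2 : τ a = (hi a - x a) / d a := by simp [τ, h]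
        rw [h2, le_div_iff₀ h] at h1
        linarith
  · by_cases h : 0 < d b
    · refine ⟨hi b, ?_⟩
      simp only [τ, h, if_true]
      field_simp
      ring
    · refine ⟨lo b, ?_⟩
      simp only [τ, h, if_false]
      field_simp
      ring

/-- Integrality of circulations: a real circulation between integral bounds can be replaced by an
integral one. -/
theorem exists_int_circulation {N A : Type*} [Fintype N] [DecidableEq N] [Fintype A]
    (s t : A → N) (lo hi : A → ℤ) (x : A → ℝ)
    (hlo : ∀ a, (lo a : ℝ) ≤ x a) (hhi : ∀ a, x a ≤ hi a)
    (hx : ∀ v, ∑ a with s a = v, x a = ∑ a with t a = v, x a) :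
    ∃ z : A → ℤ, (∀ a, lo a ≤ z a) ∧ (∀ a, z a ≤ hi a) ∧
      ∀ v, ∑ a with s a = v, z a = ∑ a with t a = v, z a := by
  classical
  induction hk : #{a | ¬ ∃ z : ℤ, x a = z} using Nat.strong_induction_on generalizing x with
  | _ k ih =>
    set F : Finset A := {a | ¬ ∃ z : ℤ, x a = z} with hFdef
    have hF : ∀ a, a ∈ F ↔ ¬ ∃ z : ℤ, x a = z := by simp [hFdef]
    by_cases hne : F.Nonempty
    · obtain ⟨d, hd0, hoff, hcons⟩ := exists_ne_zero_circulation s t F hne (by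
        intro v hv
        -- Conservation at `v` would make a lone fractional arc end there a difference of integers.
        have hsplit : ∀ g : A → N, ∃ w : ℤ,
            ∑ a with g a = v, x a = (∑ a ∈ F with g a = v, x a) + w := by
          intro g
          choose! y hy using fun a (ha : a ∉ F) => not_not.1 (mt (hF a).2 ha)
          refine ⟨∑ a with g a = v ∧ a ∉ F, y a, ?_⟩
          rw [← sum_filter_add_sum_filter_not _ (· ∈ F), filter_filter, filter_filter]
          congr 1
          · refine sum_congr ?_ fun _ _ => rfl
            ext a; simp [and_comm]
          · push_cast
            exact sum_congr rfl fun a ha => hy a (mem_filter.1 ha).2.2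
        obtain ⟨w₁, h₁⟩ := hsplit s
        obtain ⟨w₂, h₂⟩ := hsplit t
        have h := hx v
        rw [h₁, h₂] at h
        rcases Nat.add_eq_one_iff.1 hv with ⟨e₁, e₂⟩ | ⟨e₁, e₂⟩
        · rw [card_eq_zero] at e₁
          obtain ⟨a, ha⟩ := card_eq_one.1 e₂
          have haF : a ∈ F := (mem_filter.1 (ha ▸ mem_singleton_self a)).1
          rw [e₁, ha, sum_empty, sum_singleton] at h
          exact (hF a).1 haF ⟨w₁ - w₂, by push_cast; linarith⟩
        · rw [card_eq_zero] at e₂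
          obtain ⟨a, ha⟩ := card_eq_one.1 e₁
          have haF : a ∈ F := (mem_filter.1 (ha ▸ mem_singleton_self a)).1
          rw [e₂, ha, sum_empty, sum_singleton] at h
          exact (hF a).1 haF ⟨w₂ - w₁, by push_cast; linarith⟩)
      have hint : ∀ a, (∃ z : ℤ, x a = z) → d a = 0 := fun a ha =>
        hoff a fun h => (hF a).1 h ha
      obtain ⟨c, hc1, hc2, b, hb1, hb2⟩ := exists_smul_add_mem_box x d lo hi hlo hhi hd0 hint
      refine ih _ ?_ (fun a => x a + c * d a) hc1 hc2 ?_ rfl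
      · rw [← hk]
        refine card_lt_card ⟨fun a ha => ?_, fun hsub => ?_⟩
        · rw [hF]
          intro hxa
          refine (mem_filter.1 ha).2 ?_
          simpa [hint a hxa] using hxa
        · exact (mem_filter.1 (hsub ((hF b).2 hb1))).2 hb2
      · intro v
        rw [sum_add_distrib, sum_add_distrib, ← mul_sum, ← mul_sum, hx v, hcons v]
    · have hall : ∀ a, ∃ z : ℤ, x a = z := fun a =>
        not_not.1 fun h => hne ⟨a, (hF a).2 h⟩
      choose z hz using hall
      refine ⟨z, fun a => ?_, fun a => ?_, fun v => ?_⟩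
      · exact_mod_cast (hz a) ▸ hlo a
      · exact_mod_cast (hz a) ▸ hhi a
      · have := hx v
        simp_rw [hz] at this
        exact_mod_cast this

/-! ### Balanced rounding -/

lemma sum_filter_sum_filter_eq {E W B R : Type*} [Fintype E] [Fintype W] [DecidableEq W]
    [DecidableEq B] [AddCommMonoid R] (a : E → W) (b : W → B) (x : E → R) (v : B) :
    ∑ w with b w = v, ∑ e with a e = w, x e = ∑ e with b (a e) = v, x e := by
  rw [← sum_fiberwise_of_maps_to (s := ({e | b (a e) = v} : Finset E)) (g := a)
    (t := {w | b w = v}) (by simp)]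
  refine sum_congr rfl fun w hw => sum_congr ?_ fun _ _ => rfl
  ext e
  have := (mem_filter.1 hw).2
  simp only [mem_filter, mem_univ, true_and]
  constructor
  · rintro rfl; exact ⟨this, rfl⟩
  · exact And.right

/-- Simultaneous rounding along a chain of coarser and coarser partitions (the fibres of `a`,
`b ∘ a` and `c ∘ b ∘ a`) and along one further partition (the fibres of `g`). -/
theorem exists_int_rounding {E W B C T : Type*} [Fintype E] [Fintype W] [Fintype B] [Fintype C]
    [Fintype T] [DecidableEq W] [DecidableEq B] [DecidableEq C] [DecidableEq T]
    (a : E → W) (b : W → B) (c : B → C) (g : E → T) (x : E → ℝ) :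
    ∃ z : E → ℤ, (∀ e, ⌊x e⌋ ≤ z e ∧ z e ≤ ⌈x e⌉) ∧
      (∀ w, ∑ e with a e = w, z e ≤ ⌈∑ e with a e = w, x e⌉) ∧
      (∀ w, ⌊∑ e with b (a e) = w, x e⌋ ≤ ∑ e with b (a e) = w, z e) ∧
      (∀ w, ⌊∑ e with c (b (a e)) = w, x e⌋ ≤ ∑ e with c (b (a e)) = w, z e ∧
        ∑ e with c (b (a e)) = w, z e ≤ ⌈∑ e with c (b (a e)) = w, x e⌉) ∧
      (∀ w, ⌊∑ e with g e = w, x e⌋ ≤ ∑ e with g e = w, z e ∧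
        ∑ e with g e = w, z e ≤ ⌈∑ e with g e = w, x e⌉) := by
  classical
  -- The network: flow leaves the hub `none`, descends the tree `C`, `B`, `W`, crosses an arc for
  -- each `e` into `g e`, and returns to the hub. Each remaining arc carries the sum over one fibre,
  -- so bounds on arcs are bounds on fibre sums.
  let s : E ⊕ W ⊕ B ⊕ C ⊕ T → Option (W ⊕ B ⊕ C ⊕ T) :=
    Sum.elim (fun e => some (.inl (a e))) <| Sum.elim (fun w => some (.inr (.inl (b w)))) <|
    Sum.elim (fun w => some (.inr (.inr (.inl (c w))))) <|
    Sum.elim (fun _ => none) (fun w => some (.inr (.inr (.inr w))))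
  let t : E ⊕ W ⊕ B ⊕ C ⊕ T → Option (W ⊕ B ⊕ C ⊕ T) :=
    Sum.elim (fun e => some (.inr (.inr (.inr (g e))))) <| Sum.elim (fun w => some (.inl w)) <|
    Sum.elim (fun w => some (.inr (.inl w))) <|
    Sum.elim (fun w => some (.inr (.inr (.inl w)))) (fun _ => none)
  let y : E ⊕ W ⊕ B ⊕ C ⊕ T → ℝ :=
    Sum.elim x <| Sum.elim (fun w => ∑ e with a e = w, x e) <|
    Sum.elim (fun w => ∑ e with b (a e) = w, x e) <|
    Sum.elim (fun w => ∑ e with c (b (a e)) = w, x e) (fun w => ∑ e with g e = w, x e)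
  obtain ⟨z, hz1, hz2, hz3⟩ := exists_int_circulation s t (fun e => ⌊y e⌋) (fun e => ⌈y e⌉) y
    (fun e => Int.floor_le _) (fun e => Int.le_ceil _) (by
      intro v
      simp_rw [sum_filter, Fintype.sum_sum_type]
      rcases v with _ | w | w | w | w <;>
        simp [s, t, y, ← sum_filter, sum_fiberwise, sum_filter_sum_filter_eq])
  simp_rw [sum_filter, Fintype.sum_sum_type] at hz3
  have hW : ∀ w, z (.inr (.inl w)) = ∑ e with a e = w, z (.inl e) := fun w => by
    simpa [s, t, ← sum_filter] using (hz3 (some (.inl w))).symm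
  have hB : ∀ w, z (.inr (.inr (.inl w))) = ∑ e with b (a e) = w, z (.inl e) := fun w => by
    simpa [s, t, ← sum_filter, hW, sum_filter_sum_filter_eq] using
      (hz3 (some (.inr (.inl w)))).symm
  have hC : ∀ w, z (.inr (.inr (.inr (.inl w)))) = ∑ e with c (b (a e)) = w, z (.inl e) :=
    fun w => by
      simpa [s, t, ← sum_filter, hB, sum_filter_sum_filter_eq] using
        (hz3 (some (.inr (.inr (.inl w))))).symm
  have hT : ∀ w, z (.inr (.inr (.inr (.inr w)))) = ∑ e with g e = w, z (.inl e) := fun w => by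
    simpa [s, t, ← sum_filter] using hz3 (some (.inr (.inr (.inr w))))
  refine ⟨fun e => z (.inl e), fun e => ⟨hz1 _, hz2 _⟩, fun w => hW w ▸ hz2 _,
    fun w => hB w ▸ hz1 _, fun w => hC w ▸ ⟨hz1 _, hz2 _⟩, fun w => hT w ▸ ⟨hz1 _, hz2 _⟩⟩

/-- Given weights `p e ≤ m`, there is a set `Z` that contains about `p e / m` of each `e`: exactly
where the total weight of a fibre of `f` or of `g` is a multiple of `m`, and up to rounding on the
fibres of `(f, q)` and on the parts of the fibres of `f` that `big` cuts out. -/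
lemma exists_balanced_subset {E ι W T : Type*} [Fintype E] [DecidableEq E] [Fintype ι]
    [Fintype W] [DecidableEq ι] [DecidableEq W] [DecidableEq T] {m : ℕ} (hm : 0 < m)
    (p : E → ℕ) (hp : ∀ e, p e ≤ m) (f : E → ι) (q : E → W) (g : E → T)
    (big : ι → W → Prop) [∀ i w, Decidable (big i w)] :
    ∃ Z : Finset E, (∀ e ∈ Z, 0 < p e) ∧
      (∀ i k, ∑ e with f e = i, p e = m * k → #{e ∈ Z | f e = i} = k) ∧
      (∀ u k, ∑ e with g e = u, p e = m * k → #{e ∈ Z | g e = u} = k) ∧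
      (∀ i w, m * #{e ∈ Z | f e = i ∧ q e = w} < ∑ e with f e = i ∧ q e = w, p e + m) ∧
      (∀ i, m ≤ ∑ e with f e = i ∧ big i (q e), p e → ∃ e ∈ Z, f e = i ∧ big i (q e)) := by
  have hm' : (0 : ℝ) < m := by exact_mod_cast hm
  -- The chain refines colour, then colour and `big`, then colour and wing. The image of `g`
  -- replaces `T`, which need not be finite.
  obtain ⟨z, hz, hw, hb, hc, ht⟩ := exists_int_rounding (W := ι × Bool × W) (B := ι × Bool) (C := ι)
    (T := univ.image g)
    (fun e => (f e, decide (big (f e) (q e)), q e)) (fun w => (w.1, w.2.1)) (fun b => b.1)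
    (fun e => ⟨g e, mem_image_of_mem _ (mem_univ e)⟩) (fun e => (p e : ℝ) / m)
  have hz01 : ∀ e, z e = 0 ∨ z e = 1 := by
    intro e
    have h0 : (0 : ℤ) ≤ ⌊(p e : ℝ) / m⌋ := Int.floor_nonneg.2 (by positivity)
    have h1 : ⌈(p e : ℝ) / m⌉ ≤ 1 := by
      rw [Int.ceil_le, Int.cast_one, div_le_one hm']
      exact_mod_cast hp e
    have := hz e
    omega
  have hzcard : ∀ P : E → Prop, ∀ [DecidablePred P],
      ∑ e with P e, z e = (#{e ∈ ({e | z e = 1} : Finset E) | P e} : ℕ) := by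
    intro P _
    rw [filter_filter, card_eq_sum_ones, Nat.cast_sum, sum_filter, sum_filter]
    refine sum_congr rfl fun e _ => ?_
    rcases hz01 e with h | h <;> simp [h]
  have hdiv : ∀ s : Finset E, ∑ e ∈ s, (p e : ℝ) / m = ((∑ e ∈ s, p e : ℕ) : ℝ) / m := by
    intro s
    rw [Nat.cast_sum, sum_div]
  have hexact : ∀ (s : Finset E) (k : ℕ) (y : ℤ), ∑ e ∈ s, p e = m * k →
      ⌊∑ e ∈ s, (p e : ℝ) / m⌋ ≤ y ∧ y ≤ ⌈∑ e ∈ s, (p e : ℝ) / m⌉ → y = k := by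
    intro s k y hs hy
    rw [hdiv, hs, Nat.cast_mul, mul_div_cancel_left₀ _ hm'.ne', Int.floor_natCast,
      Int.ceil_natCast] at hy
    omega
  refine ⟨({e | z e = 1} : Finset E), fun e he => ?_, fun i k hk => ?_, fun u k hk => ?_,
    fun i w => ?_, fun i hi => ?_⟩
  · by_contra h
    have h1 := (hz e).2
    rw [Nat.eq_zero_of_not_pos h, (mem_filter.1 he).2] at h1
    simp at h1
  · have := hexact _ k _ hk (hc i)
    rw [hzcard] at this
    exact_mod_cast this
  · by_cases hu : u ∈ univ.image g
    · have h := ht ⟨u, hu⟩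
      simp only [Subtype.mk.injEq] at h
      have := hexact _ k _ hk h
      rw [hzcard] at this
      exact_mod_cast this
    · have hne : ∀ e, g e ≠ u := fun e he => hu (mem_image.2 ⟨e, mem_univ e, he⟩)
      simp only [hne, filter_false, sum_empty, card_empty] at hk ⊢
      rcases Nat.mul_eq_zero.1 hk.symm with h | h <;> omega
  · have h := hw (i, decide (big i w), w)
    -- The Boolean is determined by colour and wing, so the finest fibres are exactly the wings.
    have hiff : ∀ e, ((f e, decide (big (f e) (q e)), q e) = (i, decide (big i w), w)) ↔
        (f e = i ∧ q e = w) := by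
      intro e
      simp only [Prod.mk.injEq]
      constructor
      · exact fun h => ⟨h.1, h.2.2⟩
      · rintro ⟨rfl, rfl⟩; exact ⟨rfl, rfl, rfl⟩
    simp only [hiff] at h
    rw [hzcard, hdiv] at h
    have h2 := (Int.cast_le (R := ℝ).2 h).trans_lt (Int.ceil_lt_add_one _)
    rw [← sub_lt_iff_lt_add, lt_div_iff₀ hm', Int.cast_natCast] at h2
    have h3 : (m : ℝ) * (#{e ∈ ({e | z e = 1} : Finset E) | f e = i ∧ q e = w} : ℕ) <
        (∑ e with f e = i ∧ q e = w, p e : ℕ) + m := by linarith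
    exact_mod_cast h3
  · have h := hb (i, true)
    have hiff : ∀ e, ((f e, decide (big (f e) (q e))) = (i, true)) ↔
        (f e = i ∧ big i (q e)) := by
      intro e
      simp only [Prod.mk.injEq, decide_eq_true_eq]
      constructor
      · rintro ⟨rfl, he⟩; exact ⟨rfl, he⟩
      · rintro ⟨rfl, he⟩; exact ⟨rfl, he⟩
    simp only [hiff] at h
    rw [hzcard, hdiv] at h
    have h1 : (1 : ℤ) ≤ ⌊((∑ e with f e = i ∧ big i (q e), p e : ℕ) : ℝ) / m⌋ := by
      rw [Int.le_floor, Int.cast_one, one_le_div hm']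
      exact_mod_cast hi
    have h2 : 0 < #{e ∈ ({e | z e = 1} : Finset E) | f e = i ∧ big i (q e)} := by omega
    obtain ⟨e, he⟩ := card_pos.1 h2
    exact ⟨e, (mem_filter.1 he).1, (mem_filter.1 he).2⟩

/-! ### Amalgamations, wings and detachment of one vertex -/

/-- Consider an `h`-uniform hypergraph on the vertices `0, …, j - 1` and a further vertex `α`, in
which the edge `e` consists of `p e` copies of `α` and of the set `U e`, and has colour `f e`.
Such a hypergraph is an amalgamation of `lam` copies of the complete `h`-uniform hypergraph of
order `n`, in which `α` stands for `n - j` vertices, and every colour class `i` has the degrees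
that come from an `r i`-regular one. -/
structure IsAmalgamation {E ι : Type*} [Fintype E] [DecidableEq ι] (n h lam : ℕ)
    (r : ι → ℕ) (f : E → ι) (j : ℕ) (p : E → ℕ) (U : E → Finset ℕ) : Prop where
  subset : ∀ e, U e ⊆ range j
  uniform : ∀ e, #(U e) + p e = h
  degree_amalgam : ∀ i, ∑ e with f e = i, p e = r i * (n - j)
  degree : ∀ i, ∀ u < j, #{e | f e = i ∧ u ∈ U e} = r i
  mult : ∀ T ⊆ range j, ∀ s, #T + s = h → #{e | U e = T} = lam * (n - j).choose s

/-- Two edges of colour `i` share a vertex other than `α`. -/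
def Meets {E ι : Type*} (f : E → ι) (U : E → Finset ℕ) (i : ι) (a b : E) : Prop :=
  f a = i ∧ f b = i ∧ ∃ u, u ∈ U a ∧ u ∈ U b

/-- The edges of colour `i` are partitioned, by a labelling `q`, into at most `d * m + 1` classes,
each of which meets `α` and is connected after the removal of `α`. -/
structure HasWings {E ι W : Type*} [Fintype E] [DecidableEq ι] [DecidableEq W] (f : E → ι)
    (p : E → ℕ) (U : E → Finset ℕ) (q : E → W) (i : ι) (d m : ℕ) : Prop where
  card_le : #(({e | f e = i} : Finset E).image q) ≤ d * m + 1
  exists_pos : ∀ e, f e = i → ∃ e', f e' = i ∧ q e' = q e ∧ 0 < p e'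
  linked : ∀ e e', f e = i → f e' = i → q e = q e' → Relation.ReflTransGen (Meets f U i) e e'

section Detach

variable {E ι W : Type*} [Fintype E] [DecidableEq E] [DecidableEq ι]

/-- Detaching a vertex `j` from `α` along a balanced set `Z` of edges. -/
lemma IsAmalgamation.detach {n h lam : ℕ} {r : ι → ℕ} {f : E → ι} {j : ℕ} {p : E → ℕ}
    {U : E → Finset ℕ} (H : IsAmalgamation n h lam r f j p U) (hj : j < n) (Z : Finset E)
    (hZ : ∀ e ∈ Z, 0 < p e) (hf : ∀ i, #{e ∈ Z | f e = i} = r i)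
    (hU : ∀ T ⊆ range j, ∀ s, #T + (s + 1) = h →
      #{e ∈ Z | U e = T} = lam * (n - (j + 1)).choose s) :
    IsAmalgamation n h lam r f (j + 1) (fun e => if e ∈ Z then p e - 1 else p e)
      (fun e => if e ∈ Z then insert j (U e) else U e) := by
  have hjU : ∀ e, j ∉ U e := fun e he => by simpa using H.subset e he
  obtain ⟨m, hm⟩ : ∃ m, n - j = m + 1 := ⟨n - j - 1, by omega⟩
  have hm' : n - (j + 1) = m := by omega
  refine ⟨fun e => ?_, fun e => ?_, fun i => ?_, fun i u hu => ?_, fun T hT s hs => ?_⟩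
  · have := (H.subset e).trans (range_subset_range.2 j.le_succ)
    split_ifs
    · exact insert_subset (by simp) this
    · exact this
  · have := H.uniform e
    split_ifs with he
    · have := hZ e he
      rw [card_insert_of_notMem (hjU e)]
      omega
    · exact this
  · have h1 : ∑ e with f e = i, p e =
        ∑ e with f e = i, (if e ∈ Z then p e - 1 else p e) + #{e ∈ Z | f e = i} := by
      rw [card_eq_sum_ones, sum_filter, sum_filter, sum_filter, ← sum_filter_add_sum_filter_not
        univ (· ∈ Z) (fun e => if f e = i then p e else 0), ← sum_filter_add_sum_filter_not
        univ (· ∈ Z) (fun e => if f e = i then if e ∈ Z then p e - 1 else p e else 0)]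
      have hZu : ({e | e ∈ Z} : Finset E) = Z := by ext; simp
      rw [add_right_comm, hZu, ← sum_add_distrib]
      congr 1
      · refine sum_congr rfl fun e he => ?_
        have := hZ e he
        simp only [he, if_true]
        split_ifs <;> omega
      · refine sum_congr rfl fun e he => ?_
        simp [(mem_filter.1 he).2]
    rw [H.degree_amalgam, hf, hm] at h1
    rw [hm']
    have : r i * (m + 1) = r i * m + r i := by ring
    omega
  · rcases Nat.lt_succ_iff_lt_or_eq.1 hu with hu | rfl
    · rw [← H.degree i u hu]
      congr 1
      ext e
      simp only [mem_filter, mem_univ, true_and]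
      split_ifs
      · simp [hu.ne]
      · rfl
    · rw [← hf i]
      congr 1
      ext e
      simp only [mem_filter, mem_univ, true_and]
      split_ifs with he
      · simp [he]
      · simp [he, hjU e]
  -- Edges of type `T` come from `T.erase j` inside `Z` if `j ∈ T`, and from `T` outside `Z`
  -- otherwise; the second count is Pascal's rule.
  · by_cases hjT : j ∈ T
    · have hT' : T.erase j ⊆ range j := by
        intro u hu
        have h1 := mem_range.1 (hT (mem_of_mem_erase hu))
        have h2 := ne_of_mem_erase hu
        rw [mem_range]; omega
      have hc := card_erase_add_one hjT
      rw [← hU _ hT' s (by omega)]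
      congr 1
      ext e
      simp only [mem_filter, mem_univ, true_and]
      split_ifs with he
      · simp only [he, true_and]
        constructor
        · rintro rfl; rw [erase_insert (hjU e)]
        · intro h; rw [h, insert_erase hjT]
      · simp only [he, false_and, iff_false]
        rintro rfl
        exact hjU e hjT
    · have hT' : T ⊆ range j := by
        intro u hu
        have h1 := mem_range.1 (hT hu)
        have h2 : u ≠ j := fun h => hjT (h ▸ hu)
        rw [mem_range]; omega
      have h1 := H.mult T hT' s hs
      have h2 : #{e | U e = T} = #{e ∈ Z | U e = T} + #{e | e ∉ Z ∧ U e = T} := by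
        rw [← card_filter_add_card_filter_not (s := ({e | U e = T} : Finset E)) (· ∈ Z)]
        congr 2
        · ext; simp [and_comm]
        · ext; simp [and_comm]
      have h3 : ({e | (if e ∈ Z then insert j (U e) else U e) = T} : Finset E) =
          ({e | e ∉ Z ∧ U e = T} : Finset E) := by
        ext e
        simp only [mem_filter, mem_univ, true_and]
        split_ifs with he
        · simp only [he, not_true, false_and, iff_false]
          rintro rfl
          exact hjT (mem_insert_self _ _)
        · simp [he]
      rw [h3, hm']
      rcases s with _ | s
      · have h4 : #{e ∈ Z | U e = T} = 0 := by
          rw [card_eq_zero, filter_eq_empty_iff]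
          rintro e he rfl
          have := hZ e he
          have := H.uniform e
          omega
        rw [h1, h4] at h2
        simpa using h2.symm
      · rw [h1, hU T hT' s hs, hm, hm', Nat.choose_succ_succ', mul_add] at h2
        omega

/-- The merged labelling after a detachment along `Z`: all classes of colour `i` that meet `Z`
become one class, named `w₀ i`. -/
def mergeWings [DecidableEq W] (f : E → ι) (q : E → W) (Z : Finset E) (w₀ : ι → W) (e : E) : W :=
  if ∃ e' ∈ Z, f e' = f e ∧ q e' = q e then w₀ (f e) else q e

/-- Numerical core of the connectivity argument. -/
lemma card_touched_bound {W : Type*} [DecidableEq W] (Q : Finset W) (d z : W → ℕ) {r m : ℕ}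
    (hm : 0 < m) (hr : 1 ≤ r) (hd : ∀ w ∈ Q, 0 < d w) (hdsum : ∑ w ∈ Q, d w = r * m)
    (hzsum : ∑ w ∈ Q, z w = r) (hzd : ∀ w ∈ Q, m * z w < d w + m)
    (hQ : #Q ≤ (r - 1) * m + 1) :
    #Q ≤ (r - 1) * (m - 1) + #{w ∈ Q | 0 < z w} := by
  obtain ⟨m, rfl⟩ : ∃ m', m = m' + 1 := ⟨m - 1, by omega⟩
  obtain ⟨r, rfl⟩ : ∃ r', r = r' + 1 := ⟨r - 1, by omega⟩
  simp only [Nat.add_sub_cancel] at hQ ⊢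
  have hcard : #{w ∈ Q | 0 < z w} = ∑ w ∈ Q, if 0 < z w then 1 else 0 := by
    rw [card_filter]
  -- If no wing is hit twice, `r` wings are touched and `hQ` suffices. Otherwise a wing hit twice
  -- has weight above `m`, and this surplus alone bounds `#Q`, without `hQ`.
  by_cases hall : ∀ w ∈ Q, z w ≤ 1
  · have : #{w ∈ Q | 0 < z w} = r + 1 := by
      rw [hcard, ← hzsum]
      refine sum_congr rfl fun w hw => ?_
      have := hall w hw
      split_ifs <;> omega
    rw [this]
    linarith
  · push Not at hall
    obtain ⟨w₀, hw₀, hz₀⟩ := hall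
    have key : ∀ w ∈ Q, z w + 1 + (if w = w₀ then m else 0) ≤
        d w + (if 0 < z w then 1 else 0) := by
      intro w hw
      have h1 := hzd w hw
      have h2 := hd w hw
      rcases Nat.eq_zero_or_pos (z w) with h0 | h0
      · have : w ≠ w₀ := by rintro rfl; omega
        simp [h0, this]; omega
      · obtain ⟨y, hy⟩ : ∃ y, z w = y + 1 := ⟨z w - 1, by omega⟩
        rw [if_pos h0]
        split_ifs with h
        · subst h
          obtain ⟨x, rfl⟩ : ∃ x, y = x + 1 := ⟨y - 1, by omega⟩
          rw [hy] at h1 ⊢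
          nlinarith [Nat.zero_le (m * x)]
        · rw [hy] at h1 ⊢
          nlinarith [Nat.zero_le (m * y)]
    have hs := sum_le_sum key
    rw [sum_add_distrib, sum_add_distrib, sum_add_distrib, hzsum, hdsum, ← hcard, sum_const,
      smul_eq_mul, mul_one, sum_ite_eq' Q w₀, if_pos hw₀] at hs
    nlinarith

/-- Classes of weight at least two have total weight at least `m`. -/
lemma le_sum_of_two_le {W : Type*} (Q : Finset W) (d : W → ℕ) {r m : ℕ} (hm : 2 ≤ m)
    (hr : 1 ≤ r) (hd : ∀ w ∈ Q, 0 < d w) (hdsum : ∑ w ∈ Q, d w = r * m)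
    (hQ : #Q ≤ (r - 1) * m + 1) : m ≤ ∑ w ∈ Q with 2 ≤ d w, d w := by
  obtain ⟨r, rfl⟩ : ∃ r', r = r' + 1 := ⟨r - 1, by omega⟩
  simp only [Nat.add_sub_cancel] at hQ
  have h1 := sum_filter_add_sum_filter_not Q (fun w => 2 ≤ d w) d
  have h2 := card_filter_add_card_filter_not (s := Q) (fun w => 2 ≤ d w)
  have h3 : ∑ w ∈ Q with ¬ 2 ≤ d w, d w = #{w ∈ Q | ¬ 2 ≤ d w} := by
    rw [card_eq_sum_ones]
    refine sum_congr rfl fun w hw => ?_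
    have h4 := hd w (mem_filter.1 hw).1
    have h5 := (mem_filter.1 hw).2
    omega
  rw [h3, hdsum] at h1
  have h6 : (r + 1) * m = r * m + m := by ring
  rcases Nat.eq_zero_or_pos #{w ∈ Q | 2 ≤ d w} with h0 | h0
  · rw [card_eq_zero] at h0
    rw [h0, sum_empty] at h1
    omega
  · omega

/-- The wing structure survives the detachment. -/
lemma HasWings.detach [DecidableEq W] {f : E → ι} {p : E → ℕ} {U : E → Finset ℕ} {q : E → W}
    {i : ι} {r m j : ℕ} (H : HasWings f p U q i (r - 1) m) (hr : 1 ≤ r) (hm : 2 ≤ m)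
    (hp : ∑ e with f e = i, p e = r * m) (Z : Finset E) (hf : #{e ∈ Z | f e = i} = r)
    (hZq : ∀ w, m * #{e ∈ Z | f e = i ∧ q e = w} < ∑ e with f e = i ∧ q e = w, p e + m)
    (hbig : m ≤ ∑ e with f e = i ∧ 2 ≤ ∑ e' with f e' = i ∧ q e' = q e, p e', p e →
      ∃ e ∈ Z, f e = i ∧ 2 ≤ ∑ e' with f e' = i ∧ q e' = q e, p e')
    (w₀ : ι → W) (hw₀ : ∃ e ∈ Z, f e = i ∧ q e = w₀ i) :
    HasWings f (fun e => if e ∈ Z then p e - 1 else p e)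
      (fun e => if e ∈ Z then insert j (U e) else U e) (mergeWings f q Z w₀) i
      (r - 1) (m - 1) := by
  set Q := ({e | f e = i} : Finset E).image q with hQ
  set d : W → ℕ := fun w => ∑ e with f e = i ∧ q e = w, p e with hd
  set z : W → ℕ := fun w => #{e ∈ Z | f e = i ∧ q e = w} with hz
  have hmaps : ∀ e, f e = i → q e ∈ Q := fun e he => mem_image_of_mem _ (by simp [he])
  have hdpos : ∀ w ∈ Q, 0 < d w := by
    intro w hw
    obtain ⟨e, he, rfl⟩ := mem_image.1 hw
    obtain ⟨e', h1, h2, h3⟩ := H.exists_pos e (by simpa using he)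
    exact h3.trans_le (single_le_sum (f := p) (fun _ _ => Nat.zero_le _) (by simp [h1, h2]))
  have hdsum : ∑ w ∈ Q, d w = r * m := by
    rw [← hp, ← sum_fiberwise_of_maps_to (t := Q) (g := q) (by simpa using hmaps)]
    simp only [hd, filter_filter]
  have hzsum : ∑ w ∈ Q, z w = r := by
    rw [← hf, card_eq_sum_card_fiberwise (t := Q) (f := q)
      (by intro e he; exact hmaps e (mem_filter.1 he).2)]
    simp only [hz, filter_filter]
  have hbound := card_touched_bound Q d z (by omega) hr hdpos hdsum hzsum (fun w _ => hZq w)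
    H.card_le
  have hbigsum : m ≤ ∑ e with f e = i ∧ 2 ≤ d (q e), p e := by
    refine (le_sum_of_two_le Q d hm hr hdpos hdsum H.card_le).trans_eq ?_
    rw [← sum_fiberwise_of_maps_to (s := ({e | f e = i ∧ 2 ≤ d (q e)} : Finset E))
      (t := {w ∈ Q | 2 ≤ d w}) (g := q) (by
        intro e he
        have := (mem_filter.1 he).2
        exact mem_filter.2 ⟨hmaps e this.1, this.2⟩)]
    refine sum_congr rfl fun w hw => sum_congr ?_ fun _ _ => rfl
    have := (mem_filter.1 hw).2
    ext e
    simp only [mem_filter, mem_univ, true_and]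
    constructor
    · rintro ⟨h1, rfl⟩; exact ⟨⟨h1, this⟩, rfl⟩
    · rintro ⟨⟨h1, _⟩, h2⟩; exact ⟨h1, h2⟩
  obtain ⟨e₁, he₁Z, he₁i, he₁d⟩ := hbig hbigsum
  have htouched : ∀ e, f e = i → (0 < z (q e) ↔ ∃ e' ∈ Z, f e' = f e ∧ q e' = q e) := by
    intro e he
    rw [hz, card_pos]
    constructor
    · rintro ⟨e', h⟩
      obtain ⟨h1, h2, h3⟩ := mem_filter.1 h
      exact ⟨e', h1, h2.trans he.symm, h3⟩
    · rintro ⟨e', h1, h2, h3⟩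
      exact ⟨e', mem_filter.2 ⟨h1, h2.trans he, h3⟩⟩
  have hmerge : ∀ e, f e = i → mergeWings f q Z w₀ e = if 0 < z (q e) then w₀ i else q e := by
    intro e he
    simp only [mergeWings, htouched e he, he]
  have hzw₀ : 0 < z (w₀ i) := by
    obtain ⟨e, h1, h2, h3⟩ := hw₀
    exact card_pos.2 ⟨e, mem_filter.2 ⟨h1, h2, h3⟩⟩
  have hmono : ∀ a b, Meets f U i a b →
      Meets f (fun e => if e ∈ Z then insert j (U e) else U e) i a b := by
    rintro a b ⟨ha, hb, u, hua, hub⟩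
    refine ⟨ha, hb, u, ?_, ?_⟩
    · dsimp only; split_ifs
      · exact mem_insert_of_mem hua
      · exact hua
    · dsimp only; split_ifs
      · exact mem_insert_of_mem hub
      · exact hub
  have hlink : ∀ e e', f e = i → f e' = i → q e = q e' → Relation.ReflTransGen
      (Meets f (fun e => if e ∈ Z then insert j (U e) else U e) i) e e' :=
    fun e e' h1 h2 h3 => Relation.ReflTransGen.mono hmono _ _ (H.linked e e' h1 h2 h3)
  refine ⟨?_, fun e he => ?_, fun e e' he he' hee' => ?_⟩
  -- All touched wings become one, so the count drops by their number minus one.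
  · have hsub : ({e | f e = i} : Finset E).image (mergeWings f q Z w₀) ⊆
        insert (w₀ i) {w ∈ Q | ¬ 0 < z w} := by
      intro w hw
      obtain ⟨e, he, rfl⟩ := mem_image.1 hw
      have he := (mem_filter.1 he).2
      rw [hmerge e he]
      split_ifs with h
      · exact mem_insert_self _ _
      · exact mem_insert_of_mem (mem_filter.2 ⟨hmaps e he, h⟩)
    have h1 := (card_le_card hsub).trans (card_insert_le _ _)
    have h2 := card_filter_add_card_filter_not (s := Q) (fun w => 0 < z w)
    omega
  · rw [hmerge e he]
    split_ifs with h
    -- With `m ≥ 2` and weight at least two, balance forbids `Z` from using up every copy of `α` in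
    -- the wing of `e₁`, which is part of the merged wing.
    · have hlt : z (q e₁) < d (q e₁) := by
        have h1 := hZq (q e₁)
        change m * z (q e₁) < d (q e₁) + m at h1
        change 2 ≤ d (q e₁) at he₁d
        by_contra hle
        obtain ⟨x, hx⟩ : ∃ x, d (q e₁) = x + 2 := ⟨d (q e₁) - 2, by omega⟩
        obtain ⟨y, hy⟩ : ∃ y, z (q e₁) = x + 2 + y := ⟨z (q e₁) - (x + 2), by omega⟩
        rw [hx, hy] at h1
        nlinarith
      obtain ⟨e', he', hlt'⟩ : ∃ e' ∈ ({e | f e = i ∧ q e = q e₁} : Finset E),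
          (if e' ∈ Z then 1 else 0) < p e' := by
        refine exists_lt_of_sum_lt ?_
        refine lt_of_eq_of_lt ?_ hlt
        rw [← card_filter]
        simp only [hz]
        congr 1
        ext e; simp [and_comm]
      obtain ⟨h1, h2⟩ := (mem_filter.1 he').2
      refine ⟨e', h1, ?_, ?_⟩
      · rw [hmerge e' h1, h2, if_pos]
        exact card_pos.2 ⟨e₁, mem_filter.2 ⟨he₁Z, he₁i, rfl⟩⟩
      · split_ifs at hlt' ⊢ <;> omega
    · obtain ⟨e', h1, h2, h3⟩ := H.exists_pos e he
      refine ⟨e', h1, ?_, ?_⟩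
      · rw [hmerge e' h1, h2, if_neg h]
      · have : e' ∉ Z := fun h4 => h ((htouched e he).2 ⟨e', h4, h1.trans he.symm, h2⟩)
        simpa [this] using h3
  · rw [hmerge e he, hmerge e' he'] at hee'
    by_cases h : 0 < z (q e) <;> by_cases h' : 0 < z (q e')
    · obtain ⟨a, ha1, ha2, ha3⟩ := (htouched e he).1 h
      obtain ⟨b, hb1, hb2, hb3⟩ := (htouched e' he').1 h'
      -- Go inside the old wings to edges `a` and `b` of `Z`; these now share the vertex `j`.
      refine (hlink e a he (ha2.trans he) ha3.symm).trans
        (Relation.ReflTransGen.head ?_ (hlink b e' (hb2.trans he') he' hb3))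
      exact ⟨ha2.trans he, hb2.trans he', j, by simp [ha1], by simp [hb1]⟩
    · rw [if_pos h, if_neg h'] at hee'
      exact absurd (hee' ▸ hzw₀) h'
    · rw [if_neg h, if_pos h'] at hee'
      exact absurd (hee'.symm ▸ hzw₀) h
    · rw [if_neg h, if_neg h'] at hee'
      exact hlink e e' he he' hee'

end Detach

/-! ### Iterating the detachment -/

section Existence

variable {E ι : Type*} [Fintype E] [DecidableEq ι]

/-- An edge that occurs has nonzero multiplicity, hence a nonzero binomial coefficient. This makes
the fractional weights `p e / (n - j)` at most one. -/
lemma IsAmalgamation.le_of_mem {n h lam : ℕ} {r : ι → ℕ} {f : E → ι} {j : ℕ} {p : E → ℕ}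
    {U : E → Finset ℕ} (H : IsAmalgamation n h lam r f j p U) (e : E) : p e ≤ n - j := by
  have h1 := H.mult (U e) (H.subset e) (p e) (H.uniform e)
  have h2 : 0 < #{e' | U e' = U e} := card_pos.2 ⟨e, by simp⟩
  rw [h1] at h2
  by_contra hlt
  rw [Nat.choose_eq_zero_of_lt (not_le.1 hlt)] at h2
  simp at h2

/-- The amalgamation in which all vertices are identified. -/
lemma isAmalgamation_zero {n h lam : ℕ} {r : ι → ℕ} {f : E → ι}
    (hcol : ∀ i, #{e | f e = i} * h = r i * n) (hE : Fintype.card E = lam * n.choose h) :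
    IsAmalgamation n h lam r f 0 (fun _ => h) (fun _ => ∅) where
  subset e := by simp
  uniform e := by simp
  degree_amalgam i := by simp [← hcol i]
  degree i u hu := by omega
  mult T hT s hs := by
    obtain rfl : T = ∅ := by simpa using hT
    obtain rfl : s = h := by simpa using hs
    simp [hE]

/-- Each edge is its own wing. There are `r * n / h` of them, and `h, r ≥ 2` give `r * n / h ≤ r * n
/ 2 ≤ (r - 1) * n`. -/
lemma hasWings_zero [DecidableEq E] {n h r : ℕ} {f : E → ι} {i : ι} (hh : 2 ≤ h) (hr : 2 ≤ r)
    (hcol : #{e | f e = i} * h = r * n) :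
    HasWings f (fun _ => h) (fun _ => ∅) id i (r - 1) n where
  card_le := by
    rw [image_id]
    obtain ⟨s, rfl⟩ : ∃ s, r = s + 2 := ⟨r - 2, by omega⟩
    obtain ⟨g, rfl⟩ : ∃ g, h = g + 2 := ⟨h - 2, by omega⟩
    change _ ≤ (s + 1) * n + 1
    nlinarith [Nat.zero_le (#{e | f e = i} * g), Nat.zero_le (s * n)]
  exists_pos e he := ⟨e, he, rfl, by omega⟩
  linked e e' _ _ hee' := by
    obtain rfl : e = e' := hee'
    exact .refl

/-- Starting from the amalgamation with one vertex, detach vertices one at a time while keeping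
the colour classes balanced and connected. -/
theorem exists_isAmalgamation [DecidableEq E] [Fintype ι] {n h lam : ℕ} {r : ι → ℕ} {f : E → ι}
    (hr : ∀ i, 1 ≤ r i) (hcol : ∀ i, #{e | f e = i} * h = r i * n)
    (hE : Fintype.card E = lam * n.choose h) (j : ℕ) (hj : j < n) :
    ∃ (p : E → ℕ) (U : E → Finset ℕ) (q : E → E), IsAmalgamation n h lam r f j p U ∧
      (2 ≤ h → ∀ i, 2 ≤ r i → HasWings f p U q i (r i - 1) (n - j)) := by
  induction j with
  | zero =>
    exact ⟨_, _, id, isAmalgamation_zero hcol hE, fun hh i hi => hasWings_zero hh hi (hcol i)⟩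
  | succ j ih =>
    obtain ⟨p, U, q, H, HW⟩ := ih (by omega)
    obtain ⟨Z, hZ, hZf, hZU, hZq, hZb⟩ := exists_balanced_subset (m := n - j) (by omega) p
      H.le_of_mem f q U (fun i w => 2 ≤ ∑ e' with f e' = i ∧ q e' = w, p e')
    have hZr : ∀ i, #{e ∈ Z | f e = i} = r i := fun i =>
      hZf i (r i) (by rw [H.degree_amalgam, mul_comm])
    have hw₀ : ∀ i, ∃ w, ∃ e ∈ Z, f e = i ∧ q e = w := by
      intro i
      obtain ⟨e, he⟩ := card_pos.1 ((hr i).trans_eq (hZr i).symm)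
      exact ⟨q e, e, (mem_filter.1 he).1, (mem_filter.1 he).2, rfl⟩
    choose w₀ hw₀ using hw₀
    refine ⟨_, _, mergeWings f q Z w₀, H.detach (by omega) Z hZ hZr fun T hT s hs => ?_,
      fun hh i hi => ?_⟩
    · refine hZU T _ ?_
      have h1 : ∑ e with U e = T, p e = ∑ e with U e = T, (s + 1) := by
        refine sum_congr rfl fun e he => ?_
        have h2 := H.uniform e
        rw [(mem_filter.1 he).2] at h2
        omega
      rw [h1, sum_const, H.mult T hT _ hs, smul_eq_mul]
      -- The absorption identity `(s + 1) * (m + 1).choose (s + 1) = (m + 1) * m.choose s` makes the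
      -- type total an exact multiple of `n - j`.
      obtain ⟨m, hm⟩ : ∃ m, n - j = m + 1 := ⟨n - j - 1, by omega⟩
      rw [show n - (j + 1) = m by omega, hm, mul_assoc, ← Nat.add_one_mul_choose_eq]
      ring
    · exact (HW hh i hi).detach (hr i) (by omega) (H.degree_amalgam i) Z (hZr i) (hZq i)
        (hZb i) w₀ (hw₀ i)

end Existence

/-! ### Realization as a hypergraph -/

/-- The hypergraph on `Fin (j + 1)` whose edge `e` consists of `p e` copies of the last vertex and
of the set `U e`. -/
def amalgamHypergraph {E : Type*} (j : ℕ) (p : E → ℕ) (U : E → Finset ℕ) :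
    MultiHypergraph (Fin (j + 1)) E where
  verts e := Multiset.replicate (p e) (Fin.last j) +
    ({v | v.val ∈ U e} : Finset (Fin (j + 1))).val

section Hypergraph

variable {E : Type*} {j : ℕ} {p : E → ℕ} {U : E → Finset ℕ}

lemma count_amalgamHypergraph (hU : ∀ e, U e ⊆ range j) (e : E) (v : Fin (j + 1)) :
    ((amalgamHypergraph j p U).verts e).count v =
      if v = Fin.last j then p e else if v.val ∈ U e then 1 else 0 := by
  have hj : j ∉ U e := fun h => by simpa using hU e h
  rw [amalgamHypergraph, Multiset.count_add, Multiset.count_replicate,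
    Multiset.count_eq_of_nodup (Finset.nodup _)]
  by_cases hv : v = Fin.last j
  · subst hv; simp [hj]
  · simp [hv, Ne.symm hv]

lemma card_filter_val_mem {s : Finset ℕ} (hs : s ⊆ range j) :
    #({v | v.val ∈ s} : Finset (Fin (j + 1))) = #s := by
  rw [← card_map Fin.valEmbedding]
  congr 1
  ext a
  simp only [mem_map, mem_filter, mem_univ, true_and, Fin.valEmbedding_apply]
  constructor
  · rintro ⟨v, hv, rfl⟩; exact hv
  · intro ha
    have := mem_range.1 (hs ha)
    exact ⟨⟨a, by omega⟩, ha, rfl⟩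

lemma verts_amalgamHypergraph_eq_iff (hU : ∀ e, U e ⊆ range j) (e : E) {s : ℕ}
    {T : Finset (Fin (j + 1))} (hT : Fin.last j ∉ T) :
    (amalgamHypergraph j p U).verts e = Multiset.replicate s (Fin.last j) + T.val ↔
      p e = s ∧ U e = T.map Fin.valEmbedding := by
  have hcount : ∀ v, (Multiset.replicate s (Fin.last j) + T.val).count v =
      if v = Fin.last j then s else if v ∈ T then 1 else 0 := by
    intro v
    rw [Multiset.count_add, Multiset.count_replicate, Multiset.count_eq_of_nodup (Finset.nodup _)]
    by_cases hv : v = Fin.last j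
    · subst hv; simp [hT]
    · simp [hv, Ne.symm hv]
  simp only [Multiset.ext, count_amalgamHypergraph hU, hcount]
  constructor
  · intro h
    refine ⟨by simpa using h (Fin.last j), ?_⟩
    have hmem : ∀ v : Fin (j + 1), v ≠ Fin.last j → (v.val ∈ U e ↔ v ∈ T) := by
      intro v hv
      have := h v
      simp only [hv, if_false] at this
      by_cases h1 : v.val ∈ U e <;> by_cases h2 : v ∈ T <;> simp_all
    ext a
    simp only [mem_map, Fin.valEmbedding_apply]
    constructor
    · intro ha
      have hlt := mem_range.1 (hU e ha)
      refine ⟨⟨a, by omega⟩, (hmem _ ?_).1 ha, rfl⟩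
      rw [Ne, Fin.ext_iff]; exact hlt.ne
    · rintro ⟨v, hv, rfl⟩
      exact (hmem v fun h => hT (h ▸ hv)).2 hv
  · rintro ⟨h1, h2⟩ v
    have : v.val ∈ U e ↔ v ∈ T := by
      rw [h2]
      exact mem_map' Fin.valEmbedding
    simp [h1, this]

end Hypergraph

/-- Any vertex other than `α` lies on an edge of colour `i`, and the wing of that edge leads to an
edge containing `α`. The bound on the number of wings plays no role here. -/
lemma HasWings.isConnected {E ι W : Type*} [Fintype E] [DecidableEq ι] [DecidableEq W]
    {f : E → ι} {j : ℕ} {p : E → ℕ} {U : E → Finset ℕ} {q : E → W} {i : ι} {d m : ℕ}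
    (H : HasWings f p U q i d m) (hU : ∀ e, U e ⊆ range j)
    (hdeg : ∀ u < j, ∃ e, f e = i ∧ u ∈ U e) :
    ((amalgamHypergraph j p U).colorClass f i).IsConnected := by
  set G := (amalgamHypergraph j p U).colorClass f i with hG
  have hsymm : Std.Symm G.Joined := ⟨fun u v ⟨e, hu, hv⟩ => ⟨e, hv, hu⟩⟩
  have hmem : ∀ (e : {e // f e = i}) (v : Fin (j + 1)), v.val ∈ U e.1 → v ∈ G.verts e := by
    intro e v hv
    exact Multiset.mem_add.2 (.inr (by simpa using hv))
  have hlink : ∀ e e', Relation.ReflTransGen (Meets f U i) e e' → ∀ (he : f e = i)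
      (he' : f e' = i), ∀ u ∈ G.verts ⟨e, he⟩, ∀ v ∈ G.verts ⟨e', he'⟩,
      Relation.ReflTransGen G.Joined u v := by
    intro e e' hee' he
    induction hee' with
    | refl => exact fun he' u hu v hv => .single ⟨⟨e, he⟩, hu, hv⟩
    | tail _ hbc ih =>
      intro he' u hu v hv
      obtain ⟨hb, hc, x, hxb, hxc⟩ := hbc
      have hx := mem_range.1 (hU _ hxb)
      exact (ih hb u hu ⟨x, by omega⟩ (hmem ⟨_, hb⟩ _ hxb)).tail
        ⟨⟨_, hc⟩, hmem ⟨_, hc⟩ ⟨x, by omega⟩ hxc, hv⟩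
  have hlast : ∀ u, Relation.ReflTransGen G.Joined u (Fin.last j) := by
    intro u
    by_cases hu : u = Fin.last j
    · rw [hu]
    · obtain ⟨e, he, hue⟩ := hdeg u (Fin.val_lt_last hu)
      obtain ⟨e', he', hq, hp⟩ := H.exists_pos e he
      refine hlink e e' (H.linked e e' he he' hq.symm) he he' u (hmem ⟨e, he⟩ u hue) _ ?_
      exact Multiset.mem_add.2 (.inl (Multiset.mem_replicate.2 ⟨hp.ne', rfl⟩))
  refine ⟨⟨Fin.last j⟩, fun u v => (hlast u).trans ?_⟩
  exact Relation.ReflTransGen.stdSymm.symm _ _ (hlast v)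

theorem theorem3 (n h lam k : ℕ) (r : Fin k → ℕ)
    (hh : 1 ≤ h) (hlam : 1 ≤ lam) (hr : ∀ i, 1 ≤ r i) (hn : h < n)
    (hdvd : ∀ i, h ∣ r i * n)
    (hsum : ∑ i, r i = lam * (n - 1).choose (h - 1))
    (ℓ : ℕ) (hℓ : 1 ≤ ℓ) (hℓn : ℓ ≤ n) :
    ∃ (V E : Type) (_ : Fintype V) (_ : DecidableEq V) (_ : Fintype E)
      (G : MultiHypergraph V E) (f : E → Fin k) (α : V),
      Fintype.card V = ℓ ∧
      G.IsUniform h ∧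
      (∀ (i : Fin k) (u : V),
        (G.colorClass f i).degree u = if u = α then r i * (n - ℓ + 1) else r i) ∧
      (∀ (p : ℕ) (U : Finset V), α ∉ U → U.card + p = h →
        G.mult α p U = lam * (n - ℓ + 1).choose p) ∧
      (2 ≤ h → ∀ i : Fin k, 2 ≤ r i → (G.colorClass f i).IsConnected) := by
  obtain ⟨j, rfl⟩ : ∃ j, ℓ = j + 1 := ⟨ℓ - 1, by omega⟩
  have hnj : n - (j + 1) + 1 = n - j := by omega
  -- The edges are created with their colours, which never change; only their vertices do.
  let E := Σ i : Fin k, Fin (r i * n / h)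
  let f : E → Fin k := Sigma.fst
  have hcol : ∀ i, #{e : E | f e = i} * h = r i * n := by
    intro i
    have : #{e : E | f e = i} = r i * n / h := by
      rw [show ({e : E | f e = i} : Finset E) = univ.map (Function.Embedding.sigmaMk i) by
        ext ⟨i', x⟩
        simp only [f, mem_filter, mem_univ, true_and, mem_map]
        constructor
        · rintro rfl; exact ⟨x, rfl⟩
        · rintro ⟨y, hy⟩; exact (congrArg Sigma.fst hy).symm]
      simp
    rw [this, Nat.div_mul_cancel (hdvd i)]
  have hE : Fintype.card E = lam * n.choose h := by
    -- Count incidences: the colour classes contribute `n * ∑ i, r i`, which `hsum` and absorption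
    -- turn into `h * lam * n.choose h`.
    refine Nat.eq_of_mul_eq_mul_right hh ?_
    obtain ⟨g, rfl⟩ : ∃ g, h = g + 1 := ⟨h - 1, by omega⟩
    obtain ⟨n, rfl⟩ : ∃ n', n = n' + 1 := ⟨n - 1, by omega⟩
    simp only [Nat.add_sub_cancel] at hsum
    rw [← card_univ, card_eq_sum_card_fiberwise (f := f) (t := univ) (by simp), sum_mul]
    simp only [hcol]
    rw [← sum_mul, hsum, mul_assoc lam, mul_assoc lam,
      ← Nat.add_one_mul_choose_eq, mul_comm (n + 1)]
  obtain ⟨p, U, q, H, HW⟩ := exists_isAmalgamation hr hcol hE j (by omega)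
  refine ⟨Fin (j + 1), E, inferInstance, inferInstance, inferInstance, amalgamHypergraph j p U, f,
    Fin.last j, by simp, fun e => ?_, fun i u => ?_, fun s T hT hs => ?_, fun h2 i hi => ?_⟩
  · rw [amalgamHypergraph, Multiset.card_add, Multiset.card_replicate, Finset.card_val,
      card_filter_val_mem (H.subset e), add_comm]
    exact H.uniform e
  · have hdeg : ((amalgamHypergraph j p U).colorClass f i).degree u =
        ∑ e with f e = i, ((amalgamHypergraph j p U).verts e).count u := by
      rw [MultiHypergraph.degree, ← sum_subtype_eq_sum_filter, Finset.subtype_univ]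
      rfl
    rw [hdeg, hnj]
    simp only [count_amalgamHypergraph H.subset]
    split_ifs with hu
    · exact H.degree_amalgam i
    · rw [← card_filter, filter_filter]
      exact H.degree i u (Fin.val_lt_last hu)
  · rw [hnj, ← H.mult (T.map Fin.valEmbedding) ?_ s (by rwa [card_map]), MultiHypergraph.mult,
      MultiHypergraph.edgeMult]
    · congr 1
      ext e
      simp only [mem_filter, mem_univ, true_and, verts_amalgamHypergraph_eq_iff H.subset e hT,
        and_iff_right_iff_imp]
      intro he
      have h1 := H.uniform e
      rw [he, card_map] at h1
      omega
    · intro a ha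
      obtain ⟨v, hv, rfl⟩ := mem_map.1 ha
      exact mem_range.2 (Fin.val_lt_last fun h => hT (h ▸ hv))
  · refine (HW h2 i hi).isConnected H.subset fun u hu => ?_
    obtain ⟨e, he⟩ := card_pos.1 ((hr i).trans_eq (H.degree i u hu).symm)
    exact ⟨e, (mem_filter.1 he).2⟩
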